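/- Let $p$ and $q$ be distinct primes, and let $K/\mathbb{Q}_p$ be a finite unramified extension with ring of integers $\mathcal{O}_K$. Let $v$ be the $p$-adic valuation on $K$, normalized so that $v(p)=1$. Let $f\in\mathcal{O}_K[x]$ be a polynomial of degree $q$ that is irreducible in the ring $\mathcal{O}_K[x]$ (not necessarily monic), let $\Delta_f\in\mathcal{O}_K$ be its discriminant, and let $\theta$ be a root of $f$ in an extension field of $K$. Then $K(\theta)/K$ is unramified if and only if $q(q-1)$ divides the integer $v(\Delta_f)$. -/

import Mathlib

open Polynomial
open scoped IntermediateField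

/-- For a domain `A` (here: the ring of integers of a local field `F`) and a field extension `L`
of `F`, the extension `L / F` is unramified when the ring of integers of `L`, i.e. the integral
closure of `A` in `L`, is an unramified `A`-algebra. -/
def IsUnramifiedExtension (A L : Type*) [CommRing A] [Field L] [Algebra A L] : Prop :=
  Algebra.Unramified A (integralClosure A L)

/-- The `p`-adic valuation on an algebraic extension `K` of `ℚ_[p]`, normalized by `v p = 1`:
`v x = - log_p |x|`, where `|x|` is the unique extension to `K` of the `p`-adic absolute value.
(The value at `x = 0` is the junk value `0`.) -/
noncomputable def extPadicVal (p : ℕ) [Fact p.Prime] (K : Type*) [Field K] [Algebra ℚ_[p] K]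
    (x : K) : ℝ :=
  -Real.logb p (spectralNorm ℚ_[p] K x)

/-!
Let `L = K(θ)`, let its degree `q` over `K` be a prime that is a unit in the valuation ring of `K`,
and let `x = θ - c` with `c` the mean of the conjugates of `θ`. The Galois group acts isometrically
on the `q` conjugates of `x`, and it acts primitively because `q` is prime; balls are blocks of the
action, so any two conjugates are equally far apart. As `∑ (x - y) = q x` over the conjugates `y`
of `x`, that distance is `|x|`. Combined with Gauss's lemma `|lc f| max(1, |θ|) ^ q = 1` this gives
`|disc f| = (|x| / max(1, |θ|) ^ 2) ^ (q (q - 1))`, whose base lies in `|K|` if and only if `|x|`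
does.

If `|a| = |x|` with `a ∈ K`, then `u = x / a` generates `L` and has `|m_u'(u)| = 1` for its minimal
polynomial `m_u`; since `m_u'(u)` lies in the different, `L / K` is unramified. Conversely, in an
unramified extension a uniformizer of `K` is still a uniformizer, so `|x| ∈ |L| = |K|`.
-/

section IsometricAction

variable (G : Type*) [Group G]

theorem isBlock_ball {X : Type*} [PseudoMetricSpace X] [IsUltrametricDist X] [MulAction G X]
    [IsIsometricSMul G X] (x : X) (r : ℝ) : MulAction.IsBlock G (Metric.ball x r) := by
  intro g h hne
  rw [Metric.smul_ball, Metric.smul_ball] at hne ⊢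
  exact (IsUltrametricDist.ball_eq_or_disjoint _ _ _).resolve_left hne

/-- Balls are blocks and the action is primitive, so the ball around `x` of radius `dist x z`, which
misses `z`, cannot contain `y`. -/
theorem dist_eq_dist_of_prime_card {X : Type*} [MetricSpace X] [IsUltrametricDist X]
    [MulAction G X] [IsIsometricSMul G X] [MulAction.IsPretransitive G X]
    (hX : (Nat.card X).Prime) {x y z : X} (hy : y ≠ x) (hz : z ≠ x) : dist x y = dist x z := by
  have := MulAction.IsPreprimitive.of_prime_card (G := G) hX
  wlog h : dist x y < dist x z generalizing y z
  · rcases (not_lt.mp h).eq_or_lt with h | h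
    · exact h.symm
    · exact (this hz hy h).symm
  have hxr : x ∈ Metric.ball x (dist x z) := Metric.mem_ball_self (dist_pos.mpr hz.symm)
  rcases (isBlock_ball G x (dist x z)).subsingleton_or_eq_univ with hs | hu
  · exact absurd (hs (Metric.mem_ball'.mpr h) hxr) hy
  · have hzr : z ∈ Metric.ball x (dist x z) := hu ▸ Set.mem_univ z
    exact absurd (Metric.mem_ball'.mp hzr) (lt_irrefl _)

end IsometricAction

theorem separable_minpoly_of_natDegree_ne_zero {K L : Type*} [Field K] [Field L] [Algebra K L]
    {x : L} (hx : IsIntegral K x) (hn : ((minpoly K x).natDegree : K) ≠ 0) :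
    (minpoly K x).Separable := by
  refine (separable_iff_derivative_ne_zero (minpoly.irreducible hx)).mpr fun h ↦ hn ?_
  have hpos := minpoly.natDegree_pos hx
  have := congrArg (coeff · ((minpoly K x).natDegree - 1)) h
  simpa [coeff_derivative, Nat.sub_add_cancel hpos, (minpoly.monic hx).coeff_natDegree,
    Nat.cast_sub hpos] using this

theorem mem_aroots_minpoly_self {K E : Type*} [Field K] [Field E] [Algebra K E] {x : E}
    (hx : IsIntegral K x) : x ∈ (minpoly K x).aroots E :=
  mem_aroots.mpr ⟨minpoly.ne_zero hx, minpoly.aeval K x⟩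

section Conjugates

variable {K E : Type*} [NontriviallyNormedField K] [IsUltrametricDist K] [CompleteSpace K]
  [NormedField E] [NormedAlgebra K E]

theorem isIsometricSMul_algEquiv [Algebra.IsAlgebraic K E] : IsIsometricSMul (E ≃ₐ[K] E) E where
  isometry_smul σ := AddMonoidHomClass.isometry_of_norm σ fun x ↦ by
    rw [NormedAlgebra.norm_eq_spectralNorm K, NormedAlgebra.norm_eq_spectralNorm K]
    exact (spectralNorm_eq_of_equiv σ x).symm

theorem norm_eq_of_isConjRoot [Algebra.IsAlgebraic K E] {x y : E} (h : IsConjRoot K x y) :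
    ‖x‖ = ‖y‖ := by
  rw [NormedAlgebra.norm_eq_spectralNorm K, NormedAlgebra.norm_eq_spectralNorm K]
  exact congrArg spectralValue h

theorem orbit_algEquiv_eq_rootSet_minpoly {K E : Type*} [Field K] [Field E] [Algebra K E]
    [Normal K E] (x : E) : MulAction.orbit (E ≃ₐ[K] E) x = (minpoly K x).rootSet E := by
  ext y
  rw [← isConjRoot_iff_mem_minpoly_rootSet (Algebra.IsIntegral.isIntegral x), IsConjRoot.comm]
  exact isConjRoot_iff_exists_algEquiv.symm

variable [Normal K E] {x : E}

theorem norm_sub_eq_norm_sub_of_isConjRoot (hq : (minpoly K x).natDegree.Prime)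
    (hsep : (minpoly K x).Separable) {y z : E} (hy : IsConjRoot K x y) (hz : IsConjRoot K x z)
    (hyx : y ≠ x) (hzx : z ≠ x) : ‖x - y‖ = ‖x - z‖ := by
  have := isIsometricSMul_algEquiv (K := K) (E := E)
  have := IsUltrametricDist.of_normedAlgebra (L := E) K
  let X := MulAction.orbit (E ≃ₐ[K] E) x
  have hX : X = (minpoly K x).rootSet E := orbit_algEquiv_eq_rootSet_minpoly x
  have hmem {w : E} (hw : IsConjRoot K x w) : w ∈ X :=
    hX ▸ (isConjRoot_iff_mem_minpoly_rootSet (Algebra.IsIntegral.isIntegral x)).mp hw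
  have hcard : Nat.card X = (minpoly K x).natDegree := by
    rw [hX, Nat.card_eq_fintype_card, card_rootSet_eq_natDegree hsep (Normal.splits ‹_› x)]
  have : IsIsometricSMul (E ≃ₐ[K] E) X := ⟨fun σ _ _ ↦ isometry_smul E σ _ _⟩
  have h := dist_eq_dist_of_prime_card (E ≃ₐ[K] E) (hcard ▸ hq) (x := ⟨x, hmem .refl⟩)
    (y := ⟨y, hmem hy⟩) (z := ⟨z, hmem hz⟩) (by simpa using hyx) (by simpa using hzx)
  rwa [Subtype.dist_eq, Subtype.dist_eq, dist_eq_norm, dist_eq_norm] at h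

/-- Summing over the conjugates `y` of an element `x` of trace zero gives `∑ (x - y) = q x`. -/
theorem norm_sub_eq_norm_of_isConjRoot (hq : (minpoly K x).natDegree.Prime)
    (hq1 : ‖((minpoly K x).natDegree : K)‖ = 1) (hx : (minpoly K x).nextCoeff = 0) {y : E}
    (hy : IsConjRoot K x y) (hyx : y ≠ x) : ‖x - y‖ = ‖x‖ := by
  have := IsUltrametricDist.of_normedAlgebra (L := E) K
  have hint := Algebra.IsIntegral.isIntegral (R := K) x
  have hsep := separable_minpoly_of_natDegree_ne_zero hint (norm_ne_zero_iff.mp (by simp [hq1]))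
  have hsplit : ((minpoly K x).map (algebraMap K E)).Splits := Normal.splits ‹_› x
  apply le_antisymm
  · have h := IsUltrametricDist.norm_add_le_max x (-y)
    rwa [← sub_eq_add_neg, norm_neg, ← norm_eq_of_isConjRoot hy, max_self] at h
  have hsum : (((minpoly K x).aroots E).map (x - ·)).sum =
      algebraMap K E (minpoly K x).natDegree * x := by
    have hroots : ((minpoly K x).aroots E).sum = 0 := by
      rw [← neg_eq_zero, aroots_def,
        ← hsplit.nextCoeff_eq_neg_sum_roots_of_monic ((minpoly.monic hint).map _),
        nextCoeff_map (algebraMap K E).injective, hx, map_zero]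
    rw [Multiset.sum_map_sub, Multiset.map_id', hroots, Multiset.map_const', Multiset.sum_replicate,
      aroots_def, ← hsplit.natDegree_eq_card_roots, natDegree_map, sub_zero, nsmul_eq_mul,
      map_natCast]
  obtain ⟨z, hz, hle⟩ := IsUltrametricDist.exists_norm_multiset_sum_le ((minpoly K x).aroots E)
    (f := (x - ·))
  rw [hsum, norm_mul, norm_algebraMap', hq1, one_mul] at hle
  by_cases hzx : z = x
  · refine hle.trans ?_
    simp [hzx]
  · have hz' : IsConjRoot K x z := (isConjRoot_iff_mem_minpoly_aroots hint).mpr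
      (hz fun h ↦ Multiset.notMem_zero x (h ▸ mem_aroots_minpoly_self hint))
    exact hle.trans_eq (norm_sub_eq_norm_sub_of_isConjRoot hq hsep hz' hy hzx hyx)

theorem norm_aeval_derivative_minpoly_of_normal (hq : (minpoly K x).natDegree.Prime)
    (hq1 : ‖((minpoly K x).natDegree : K)‖ = 1) (hx : (minpoly K x).nextCoeff = 0) :
    ‖aeval x (minpoly K x).derivative‖ = ‖x‖ ^ ((minpoly K x).natDegree - 1) := by
  classical
  have hint := Algebra.IsIntegral.isIntegral (R := K) x
  have hsep := separable_minpoly_of_natDegree_ne_zero hint (norm_ne_zero_iff.mp (by simp [hq1]))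
  have hsplit : ((minpoly K x).map (algebraMap K E)).Splits := Normal.splits ‹_› x
  have hxmem := mem_aroots_minpoly_self hint
  have hdist : ∀ y ∈ ((minpoly K x).aroots E).erase x, ‖x - y‖ = ‖x‖ := fun y hy ↦ by
    rw [(nodup_aroots_iff_of_splits (minpoly.ne_zero hint) hsplit).mpr hsep |>.mem_erase_iff] at hy
    exact norm_sub_eq_norm_of_isConjRoot hq hq1 hx
      ((isConjRoot_iff_mem_minpoly_aroots hint).mpr hy.2) hy.1
  rw [← eval_map_algebraMap, ← derivative_map,
    hsplit.eval_root_derivative ((minpoly.monic hint).map _) hxmem, ← normHom_apply,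
    map_multiset_prod, Multiset.map_map, Multiset.map_congr rfl (by exact hdist),
    Multiset.map_const', Multiset.prod_replicate, Multiset.card_erase_of_mem hxmem,
    ← hsplit.natDegree_eq_card_roots, natDegree_map, Nat.pred_eq_sub_one]

theorem norm_aeval_eq_of_isConjRoot (p : K[X]) {y : E} (h : IsConjRoot K x y) :
    ‖aeval x p‖ = ‖aeval y p‖ := by
  obtain ⟨σ, rfl⟩ := isConjRoot_iff_exists_algEquiv.mp h
  rw [aeval_algEquiv]
  exact norm_eq_of_isConjRoot (isConjRoot_of_algEquiv' _ σ)

end Conjugates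

theorem discr_map_of_injective {R S : Type*} [CommRing R] [CommRing S] [IsDomain S]
    {φ : R →+* S} (hφ : Function.Injective φ) {f : R[X]} (hf : 0 < f.natDegree) :
    (f.map φ).discr = φ f.discr := by
  have hdeg : (f.map φ).natDegree = f.natDegree := natDegree_map_eq_of_injective hφ f
  have hlc : (f.map φ).leadingCoeff ≠ 0 := by
    rw [leadingCoeff_ne_zero, Polynomial.map_ne_zero_iff hφ]
    rintro rfl
    simp at hf
  have h := resultant_deriv (natDegree_pos_iff_degree_pos.mp (hdeg ▸ hf : 0 < (f.map φ).natDegree))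
  rw [hdeg, derivative_map, resultant_map_map, resultant_deriv (natDegree_pos_iff_degree_pos.mp hf),
    leadingCoeff_map_of_injective hφ, map_mul, map_mul, map_pow, map_neg, map_one] at h
  rw [leadingCoeff_map_of_injective hφ] at hlc
  exact (mul_left_cancel₀ (mul_ne_zero (pow_ne_zero _ (neg_ne_zero.mpr one_ne_zero)) hlc) h).symm

theorem norm_discr_of_monic_of_splits {E : Type*} [NormedField E] {F : E[X]} (hF : F.Monic)
    (hsplit : F.Splits) (hdeg : 0 < F.natDegree) :
    ‖F.discr‖ = (F.roots.map (‖F.derivative.eval ·‖)).prod := by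
  have h := congrArg normHom ((resultant_deriv (natDegree_pos_iff_degree_pos.mp hdeg)).symm.trans
    (resultant_eq_prod_eval F F.derivative _ (natDegree_derivative_le F) hsplit))
  simpa only [hF.leadingCoeff, map_mul, map_pow, map_one, one_pow, one_mul, mul_one,
    map_multiset_prod, Multiset.map_map, normHom_apply, Function.comp_def, norm_neg, norm_one]
    using h

section Discriminant

variable {K E : Type*} [NontriviallyNormedField K] [IsUltrametricDist K] [CompleteSpace K]
  [NormedField E] [NormedAlgebra K E] [Normal K E]

theorem norm_discr_minpoly_of_normal (x : E) : ‖(minpoly K x).discr‖ =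
    ‖aeval x (minpoly K x).derivative‖ ^ (minpoly K x).natDegree := by
  have hint := Algebra.IsIntegral.isIntegral (R := K) x
  have hsplit : ((minpoly K x).map (algebraMap K E)).Splits := Normal.splits ‹_› x
  have hroots : ∀ y ∈ (minpoly K x).aroots E,
      ‖((minpoly K x).map (algebraMap K E)).derivative.eval y‖ =
        ‖aeval x (minpoly K x).derivative‖ := fun y hy ↦ by
    rw [derivative_map, eval_map_algebraMap]
    exact (norm_aeval_eq_of_isConjRoot _ ((isConjRoot_iff_mem_minpoly_aroots hint).mpr hy)).symm
  have h := norm_discr_of_monic_of_splits ((minpoly.monic hint).map _) hsplit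
    (by rw [natDegree_map]; exact minpoly.natDegree_pos hint)
  rw [Multiset.map_congr rfl hroots, Multiset.map_const', Multiset.prod_replicate,
    ← hsplit.natDegree_eq_card_roots, natDegree_map,
    discr_map_of_injective (algebraMap K E).injective (minpoly.natDegree_pos hint),
    norm_algebraMap'] at h
  exact h

end Discriminant

theorem discr_C_mul {R : Type*} [CommRing R] [IsDomain R] {c : R} (hc : c ≠ 0) {f : R[X]}
    (hf : 0 < f.natDegree) : (C c * f).discr = c ^ (2 * (f.natDegree - 1)) * f.discr := by
  have hdeg : (C c * f).natDegree = f.natDegree := natDegree_C_mul hc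
  have hlc : f.leadingCoeff ≠ 0 := by
    rintro h
    simp [leadingCoeff_eq_zero.mp h] at hf
  have h := resultant_deriv (natDegree_pos_iff_degree_pos.mp (hdeg ▸ hf : 0 < (C c * f).natDegree))
  rw [hdeg, derivative_C_mul, resultant_C_mul_left, resultant_C_mul_right,
    resultant_deriv (natDegree_pos_iff_degree_pos.mp hf), leadingCoeff_mul, leadingCoeff_C] at h
  have hc' : (-1 : R) ^ (f.natDegree * (f.natDegree - 1) / 2) * (c * f.leadingCoeff) ≠ 0 := by
    simp [hc, hlc]
  apply mul_left_cancel₀ hc'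
  rw [← h]
  obtain ⟨n, hn⟩ := Nat.exists_eq_succ_of_ne_zero hf.ne'
  rw [hn]
  simp only [Nat.succ_sub_one, Nat.succ_eq_add_one]
  ring
open Polynomial

section Tower

universe u

variable {K : Type*} {L : Type u} [NontriviallyNormedField K] [IsUltrametricDist K]
  [CompleteSpace K] [NormedField L] [NormedAlgebra K L]

theorem norm_algebraMap_of_isScalarTower {E : Type*} [NormedField E] [NormedAlgebra K E]
    [Algebra L E] [IsScalarTower K L E] [Algebra.IsAlgebraic K E] (x : L) :
    ‖algebraMap L E x‖ = ‖x‖ := by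
  have := Algebra.IsAlgebraic.tower_bot K L E
  rw [NormedAlgebra.norm_eq_spectralNorm K, NormedAlgebra.norm_eq_spectralNorm K]
  exact (spectralNorm.eq_of_tower x).symm

variable [Algebra.IsAlgebraic K L]

variable (K L) in
theorem exists_normal_normedAlgebra :
    ∃ (E : Type u) (_ : NormedField E) (_ : NormedAlgebra K E) (_ : Algebra L E),
      IsScalarTower K L E ∧ Normal K E := by
  have : Algebra.IsAlgebraic K (AlgebraicClosure L) := .trans K L _
  have : IsAlgClosure K (AlgebraicClosure L) := ⟨inferInstance, inferInstance⟩
  exact ⟨AlgebraicClosure L, spectralNorm.normedField K _, spectralNorm.normedAlgebra K _,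
    inferInstance, inferInstanceAs (IsScalarTower K L (AlgebraicClosure L)),
    IsAlgClosure.normal K _⟩

theorem norm_aeval_derivative_minpoly {x : L} (hq : (minpoly K x).natDegree.Prime)
    (hq1 : ‖((minpoly K x).natDegree : K)‖ = 1) (hx : (minpoly K x).nextCoeff = 0) :
    ‖aeval x (minpoly K x).derivative‖ = ‖x‖ ^ ((minpoly K x).natDegree - 1) := by
  obtain ⟨E, _, _, _, _, _⟩ := exists_normal_normedAlgebra K L
  have hmin : minpoly K (algebraMap L E x) = minpoly K x :=
    minpoly.algebraMap_eq (algebraMap L E).injective x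
  rw [← hmin] at hq hq1 hx
  simpa only [hmin, aeval_algebraMap_apply, norm_algebraMap_of_isScalarTower (K := K)]
    using norm_aeval_derivative_minpoly_of_normal hq hq1 hx

theorem norm_discr_minpoly (x : L) : ‖(minpoly K x).discr‖ =
    ‖aeval x (minpoly K x).derivative‖ ^ (minpoly K x).natDegree := by
  obtain ⟨E, _, _, _, _, _⟩ := exists_normal_normedAlgebra K L
  simpa only [minpoly.algebraMap_eq (algebraMap L E).injective, aeval_algebraMap_apply,
    norm_algebraMap_of_isScalarTower (K := K)]
    using norm_discr_minpoly_of_normal (K := K) (algebraMap L E x)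

end Tower

section TraceZeroPart

variable {K L : Type*} [Field K] [Field L] [Algebra K L]

theorem natDegree_minpoly_eq_of_finrank_prime [FiniteDimensional K L]
    (hq : (Module.finrank K L).Prime) {x : L} (hx : x ∉ Set.range (algebraMap K L)) :
    (minpoly K x).natDegree = Module.finrank K L := by
  have hint := Algebra.IsIntegral.isIntegral (R := K) x
  refine ((Nat.dvd_prime hq).mp (minpoly.degree_dvd hint)).resolve_left fun h ↦ hx ?_
  exact minpoly.natDegree_eq_one_iff.mp h

theorem nextCoeff_minpoly_eq_zero_of_trace_eq_zero [FiniteDimensional K L]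
    (h : (Module.finrank K L : K) ≠ 0) {x : L} (hx : Algebra.trace K L x = 0) :
    (minpoly K x).nextCoeff = 0 := by
  rw [trace_eq_finrank_mul_minpoly_nextCoeff, mul_neg, neg_eq_zero] at hx
  refine (mul_eq_zero.mp hx).resolve_left fun h0 ↦ h ?_
  rw [← Module.finrank_mul_finrank K K⟮x⟯ L, Nat.cast_mul, h0, mul_zero]

/-- The difference between `θ` and the arithmetic mean of its conjugates. It is the unique element
of `θ + K` of trace zero when `[L : K]` is invertible in `K`. -/
noncomputable def traceZeroPart (K : Type*) {L : Type*} [Field K] [Field L] [Algebra K L] (θ : L) :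
    L :=
  θ - algebraMap K L (Algebra.trace K L θ / Module.finrank K L)

theorem trace_traceZeroPart (h : (Module.finrank K L : K) ≠ 0) (θ : L) :
    Algebra.trace K L (traceZeroPart K θ) = 0 := by
  rw [traceZeroPart, map_sub, Algebra.trace_algebraMap, nsmul_eq_mul, mul_div_cancel₀ _ h, sub_self]

theorem traceZeroPart_notMem_range {θ : L} (hθ : θ ∉ Set.range (algebraMap K L)) :
    traceZeroPart K θ ∉ Set.range (algebraMap K L) := by
  rintro ⟨d, hd⟩
  exact hθ ⟨d + Algebra.trace K L θ / Module.finrank K L, by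
    rw [map_add, hd, traceZeroPart, sub_add_cancel]⟩

theorem aeval_derivative_minpoly_traceZeroPart (θ : L) :
    aeval (traceZeroPart K θ) (minpoly K (traceZeroPart K θ)).derivative =
      aeval θ (minpoly K θ).derivative := by
  rw [traceZeroPart, minpoly.sub_algebraMap, derivative_comp]
  simp [aeval_comp]

end TraceZeroPart

section Trace

variable {K L : Type*} [NontriviallyNormedField K] [IsUltrametricDist K] [CompleteSpace K]
  [NormedField L] [NormedAlgebra K L]

theorem norm_coeff_minpoly_le [Algebra.IsAlgebraic K L] (x : L) {i : ℕ}
    (hi : i ≤ (minpoly K x).natDegree) :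
    ‖(minpoly K x).coeff i‖ ≤ ‖x‖ ^ ((minpoly K x).natDegree - i) := by
  rcases hi.eq_or_lt with rfl | hi
  · simp [(minpoly.monic (Algebra.IsIntegral.isIntegral (R := K) x)).coeff_natDegree]
  have h : spectralValueTerms (minpoly K x) i ≤ ‖x‖ := by
    rw [NormedAlgebra.norm_eq_spectralNorm K x]
    exact le_ciSup (spectralValueTerms_bddAbove _) i
  rw [spectralValueTerms_of_lt_natDegree _ hi] at h
  have hpos : (0 : ℝ) < ((minpoly K x).natDegree : ℝ) - i := by
    rw [sub_pos]; exact_mod_cast hi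
  rw [one_div, Real.rpow_inv_le_iff_of_pos (norm_nonneg _) (norm_nonneg _) hpos,
    ← Nat.cast_sub hi.le, Real.rpow_natCast] at h
  exact h

theorem norm_coeff_zero_minpoly [Algebra.IsAlgebraic K L] (x : L) :
    ‖(minpoly K x).coeff 0‖ = ‖x‖ ^ (minpoly K x).natDegree := by
  have hd : (minpoly K x).natDegree ≠ 0 :=
    (minpoly.natDegree_pos (Algebra.IsIntegral.isIntegral x)).ne'
  rw [NormedAlgebra.norm_eq_spectralNorm K x, spectralNorm.spectralNorm_eq_norm_coeff_zero_rpow,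
    one_div, Real.rpow_inv_natCast_pow (norm_nonneg _) hd]

variable [FiniteDimensional K L]

theorem norm_trace_le (x : L) : ‖Algebra.trace K L x‖ ≤ ‖x‖ := by
  have hd := minpoly.natDegree_pos (Algebra.IsIntegral.isIntegral (R := K) x)
  rw [trace_eq_finrank_mul_minpoly_nextCoeff, norm_mul, norm_neg,
    nextCoeff_of_natDegree_pos hd]
  have h := norm_coeff_minpoly_le (K := K) x (Nat.sub_le (minpoly K x).natDegree 1)
  rw [Nat.sub_sub_self hd, pow_one] at h
  exact (mul_le_of_le_one_left (norm_nonneg _) (IsUltrametricDist.norm_natCast_le_one K _)).trans h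

theorem norm_eq_norm_traceZeroPart_or_mem_range (hq1 : ‖(Module.finrank K L : K)‖ = 1)
    (θ : L) : ‖θ‖ = ‖traceZeroPart K θ‖ ∨ ∃ c : K, ‖c‖ = ‖θ‖ := by
  have := IsUltrametricDist.of_normedAlgebra (L := L) K
  set c : K := Algebra.trace K L θ / Module.finrank K L with hc
  have hcθ : ‖c‖ ≤ ‖θ‖ := by
    rw [hc, norm_div, hq1, div_one]
    exact norm_trace_le θ
  refine or_iff_not_imp_right.mpr fun h ↦ ?_
  have hne : ‖θ‖ ≠ ‖-algebraMap K L c‖ := by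
    rw [norm_neg, norm_algebraMap']
    exact fun h' ↦ h ⟨c, h'.symm⟩
  rw [traceZeroPart, ← hc, sub_eq_add_neg, IsUltrametricDist.norm_add_eq_max_of_norm_ne_norm hne,
    norm_neg, norm_algebraMap', max_eq_left hcθ]

/-- With `T = ‖traceZeroPart K θ‖`, the maximum `M` of `1` and `‖θ‖` is a value of the norm of `K`
or equal to `T`; in the second case `T / M ^ 2 = T⁻¹`. -/
theorem exists_norm_eq_div_max_sq_iff (hq1 : ‖(Module.finrank K L : K)‖ = 1) {θ : L} :
    (∃ c : K, ‖c‖ = ‖traceZeroPart K θ‖ / max 1 ‖θ‖ ^ 2) ↔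
      ∃ c : K, ‖c‖ = ‖traceZeroPart K θ‖ := by
  set T := ‖traceZeroPart K θ‖
  have hM : max 1 ‖θ‖ = T ∨ ∃ d : K, ‖d‖ = max 1 ‖θ‖ := by
    rcases le_total ‖θ‖ 1 with h | h
    · exact .inr ⟨1, by rw [max_eq_left h, norm_one]⟩
    · rw [max_eq_right h]
      exact norm_eq_norm_traceZeroPart_or_mem_range hq1 θ
  have hM0 : max 1 ‖θ‖ ≠ 0 := (lt_max_of_lt_left one_pos).ne'
  rcases hM with hM | ⟨d, hd⟩
  · have hT : T / max 1 ‖θ‖ ^ 2 = T⁻¹ := by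
      rw [hM] at hM0 ⊢
      field_simp
    rw [hT]
    constructor <;> rintro ⟨c, hc⟩
    · exact ⟨c⁻¹, by rw [norm_inv, hc, inv_inv]⟩
    · exact ⟨c⁻¹, by rw [norm_inv, hc]⟩
  · rw [← hd] at hM0 ⊢
    constructor <;> rintro ⟨c, hc⟩
    · exact ⟨c * d ^ 2, by rw [norm_mul, norm_pow, hc]; field_simp⟩
    · exact ⟨c / d ^ 2, by rw [norm_div, norm_pow, hc]⟩

theorem norm_discr_minpoly_of_finrank_prime (hq : (Module.finrank K L).Prime)
    (hq1 : ‖(Module.finrank K L : K)‖ = 1) {θ : L} (hθ : θ ∉ Set.range (algebraMap K L)) :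
    ‖(minpoly K θ).discr‖ =
      ‖traceZeroPart K θ‖ ^ (Module.finrank K L * (Module.finrank K L - 1)) := by
  have hq0 : (Module.finrank K L : K) ≠ 0 := norm_ne_zero_iff.mp (hq1 ▸ one_ne_zero)
  have hdeg := natDegree_minpoly_eq_of_finrank_prime hq (traceZeroPart_notMem_range hθ)
  rw [norm_discr_minpoly, natDegree_minpoly_eq_of_finrank_prime hq hθ,
    ← aeval_derivative_minpoly_traceZeroPart, norm_aeval_derivative_minpoly (hdeg ▸ hq)
      (hdeg ▸ hq1) (nextCoeff_minpoly_eq_zero_of_trace_eq_zero hq0 (trace_traceZeroPart hq0 θ)),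
    hdeg, ← pow_mul, mul_comm]

end Trace

theorem exists_isUnit_coeff_of_isPrimitive {A : Type*} [CommRing A] [IsDomain A]
    [IsDiscreteValuationRing A] {f : A[X]} (hf : f.IsPrimitive) : ∃ i, IsUnit (f.coeff i) := by
  by_contra! h
  obtain ⟨ϖ, hϖ⟩ := IsDiscreteValuationRing.exists_irreducible A
  refine hϖ.not_isUnit (hf ϖ (C_dvd_iff_dvd_coeff ϖ f |>.mpr fun i ↦ ?_))
  rw [← Ideal.mem_span_singleton, ← hϖ.maximalIdeal_eq]
  exact h i

section Gauss

open NormedField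

variable {A K L : Type*} [NontriviallyNormedField K] [IsUltrametricDist K] [CompleteSpace K]
  [NormedField L] [NormedAlgebra K L] [CommRing A] [Algebra A K] [IsDomain A]
  [IsDiscreteValuationRing A]

theorem norm_leadingCoeff_mul_max_pow [Algebra.IsAlgebraic K L]
    (hA : (valuation (K := K)).Integers A) {f : A[X]} (hf : f.IsPrimitive) {θ : L}
    (hθ : f.map (algebraMap A K) = C (algebraMap A K f.leadingCoeff) * minpoly K θ) :
    ‖algebraMap A K f.leadingCoeff‖ * max 1 ‖θ‖ ^ f.natDegree = 1 := by
  have hdeg : (minpoly K θ).natDegree = f.natDegree := by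
    have hlc : algebraMap A K f.leadingCoeff ≠ 0 :=
      (map_ne_zero_iff _ hA.hom_inj).mpr (leadingCoeff_ne_zero.mpr hf.ne_zero)
    rw [← natDegree_C_mul hlc, ← hθ, natDegree_map_eq_of_injective hA.hom_inj]
  have hcoeff : ∀ i, algebraMap A K (f.coeff i) =
      algebraMap A K f.leadingCoeff * (minpoly K θ).coeff i := fun i ↦ by
    rw [← coeff_map, hθ, coeff_C_mul]
  apply le_antisymm
  · rcases le_total ‖θ‖ 1 with h | h
    · rw [max_eq_left h, one_pow, mul_one]
      exact hA.map_le_one _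
    · rw [max_eq_right h, ← hdeg, ← norm_coeff_zero_minpoly (K := K), ← norm_mul, ← hcoeff]
      exact hA.map_le_one _
  · obtain ⟨i, hi⟩ := exists_isUnit_coeff_of_isPrimitive hf
    have hi1 : ‖algebraMap A K (f.coeff i)‖ = 1 := congrArg NNReal.toReal (hA.one_of_isUnit hi)
    have hin : i ≤ (minpoly K θ).natDegree := hdeg ▸ le_natDegree_of_ne_zero hi.ne_zero
    rw [hcoeff, norm_mul] at hi1
    refine hi1.ge.trans ?_
    rw [← hdeg]
    refine mul_le_mul_of_nonneg_left ((norm_coeff_minpoly_le θ hin).trans ?_) (norm_nonneg _)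
    exact (pow_le_pow_left₀ (norm_nonneg _) (le_max_right 1 _) _).trans
      (pow_le_pow_right₀ (le_max_left _ _) (Nat.sub_le _ _))

theorem norm_discr_of_finrank_prime [FiniteDimensional K L] [Algebra A L] [IsScalarTower A K L]
    (hA : (valuation (K := K)).Integers A) (hq : (Module.finrank K L).Prime)
    (hq1 : ‖(Module.finrank K L : K)‖ = 1) {f : A[X]} (hf : f.IsPrimitive)
    (hdeg : f.natDegree = Module.finrank K L) {θ : L} (hθK : θ ∉ Set.range (algebraMap K L))
    (hθ : aeval θ f = 0) :
    ‖algebraMap A K f.discr‖ = (‖traceZeroPart K θ‖ / max 1 ‖θ‖ ^ 2) ^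
      (Module.finrank K L * (Module.finrank K L - 1)) := by
  have hmin := natDegree_minpoly_eq_of_finrank_prime hq hθK
  have hdvd : minpoly K θ ∣ f.map (algebraMap A K) :=
    minpoly.dvd K θ (by rw [aeval_map_algebraMap, hθ])
  have hF := eq_leadingCoeff_mul_of_monic_of_dvd_of_natDegree_le
    (minpoly.monic (Algebra.IsIntegral.isIntegral (R := K) θ)) hdvd
    (by rw [natDegree_map_eq_of_injective hA.hom_inj, hmin, hdeg])
  rw [leadingCoeff_map_of_injective hA.hom_inj] at hF
  have hlc : ‖algebraMap A K f.leadingCoeff‖ = (max 1 ‖θ‖ ^ Module.finrank K L)⁻¹ :=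
    eq_inv_of_mul_eq_one_left (hdeg ▸ norm_leadingCoeff_mul_max_pow hA hf hF)
  have hlc0 : algebraMap A K f.leadingCoeff ≠ 0 :=
    (map_ne_zero_iff _ hA.hom_inj).mpr (leadingCoeff_ne_zero.mpr hf.ne_zero)
  rw [← discr_map_of_injective hA.hom_inj (hdeg ▸ hq.pos), hF, discr_C_mul hlc0 (hmin ▸ hq.pos),
    norm_mul, norm_pow, norm_discr_minpoly_of_finrank_prime hq hq1 hθK, hmin, hlc, div_pow,
    div_eq_mul_inv, mul_comm, inv_pow, ← pow_mul, ← pow_mul]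
  ring_nf

end Gauss

theorem isSeparable_of_finrank_ne_zero {K L : Type*} [Field K] [Field L] [Algebra K L]
    [FiniteDimensional K L] (h : (Module.finrank K L : K) ≠ 0) : Algebra.IsSeparable K L where
  isSeparable' x := by
    have hint := Algebra.IsIntegral.isIntegral (R := K) x
    refine separable_minpoly_of_natDegree_ne_zero hint fun h0 ↦ h ?_
    obtain ⟨d, hd⟩ := minpoly.degree_dvd hint
    rw [hd, Nat.cast_mul, h0, zero_mul]

theorem isSeparable_fractionRing (A K L B : Type*) [CommRing A] [IsDomain A] [Field K]
    [Algebra A K] [IsFractionRing A K] [Field L] [Algebra K L] [Algebra.IsSeparable K L]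
    [Algebra A L] [IsScalarTower A K L] [CommRing B] [Algebra A B] [Algebra B L]
    [IsScalarTower A B L] [IsFractionRing B L] [Algebra (FractionRing A) (FractionRing B)]
    [IsScalarTower A (FractionRing A) (FractionRing B)] :
    Algebra.IsSeparable (FractionRing A) (FractionRing B) := by
  refine .of_equiv_equiv (FractionRing.algEquiv A K).symm.toRingEquiv
    (FractionRing.algEquiv B L).symm.toRingEquiv
    (IsLocalization.ringHom_ext (nonZeroDivisors A) (RingHom.ext fun a ↦ ?_))
  have hL : (FractionRing.algEquiv B L).symm (algebraMap A L a) =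
      algebraMap A (FractionRing B) a := by
    rw [IsScalarTower.algebraMap_apply A B L, AlgEquiv.commutes, ← IsScalarTower.algebraMap_apply]
  simp [hL, ← IsScalarTower.algebraMap_apply]

theorem formallyUnramified_of_isUnit_aeval_derivative_minpoly {A K L B : Type*} [CommRing A]
    [IsDedekindDomain A] [Field K] [Algebra A K] [IsFractionRing A K] [Field L] [Algebra K L]
    [FiniteDimensional K L] [Algebra.IsSeparable K L] [Algebra A L] [IsScalarTower A K L]
    [CommRing B] [IsDedekindDomain B] [Algebra A B] [Algebra B L] [IsScalarTower A B L]
    [IsFractionRing B L] [IsIntegralClosure B A L] {u : B}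
    (hu : Algebra.adjoin K {algebraMap B L u} = ⊤)
    (hder : IsUnit (aeval u (minpoly A u).derivative)) : Algebra.FormallyUnramified A B := by
  have := FaithfulSMul.trans A K L
  have := FaithfulSMul.tower_bot A B L
  have : Module.Finite A B := IsIntegralClosure.finite A K L B
  let := FractionRing.liftAlgebra A (FractionRing B)
  have := FractionRing.isScalarTower_liftAlgebra A (FractionRing B)
  have := isSeparable_fractionRing A K L B
  have htop : differentIdeal A B = ⊤ :=
    Ideal.eq_top_of_isUnit_mem _ (aeval_derivative_mem_differentIdeal A K L u hu) hder
  refine Algebra.formallyUnramified_iff_forall.mpr fun P ↦ not_dvd_differentIdeal_iff.mp ?_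
  rw [htop, Ideal.dvd_iff_le, top_le_iff]
  exact P.2.ne_top

section Integers

open NormedField IsLocalRing

theorem exists_norm_eq_zpow {K A : Type*} [NormedField K] [IsUltrametricDist K] [CommRing A]
    [IsDomain A] [IsDiscreteValuationRing A] [Algebra A K]
    (hA : (valuation (K := K)).Integers A) {ϖ : A} (hϖ : Irreducible ϖ) {x : K} (hx : x ≠ 0) :
    ∃ n : ℤ, ‖x‖ = ‖algebraMap A K ϖ‖ ^ n := by
  have hpow : ∀ a : A, a ≠ 0 → ∃ n : ℕ, ‖algebraMap A K a‖ = ‖algebraMap A K ϖ‖ ^ n := by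
    intro a ha
    obtain ⟨n, u, rfl⟩ := IsDiscreteValuationRing.eq_unit_mul_pow_irreducible ha hϖ
    have hu : ‖algebraMap A K u‖ = 1 := congrArg NNReal.toReal (hA.valuation_unit u)
    exact ⟨n, by rw [map_mul, norm_mul, hu, one_mul, map_pow, norm_pow]⟩
  obtain ⟨a, ha | ha⟩ := hA.eq_algebraMap_or_inv_eq_algebraMap x
  · obtain ⟨n, hn⟩ := hpow a (by rintro rfl; simp [hx] at ha)
    exact ⟨n, by rw [ha, hn, zpow_natCast]⟩
  · obtain ⟨n, hn⟩ := hpow a (by rintro rfl; simp [hx] at ha)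
    exact ⟨-n, by rw [zpow_neg, zpow_natCast, ← hn, ← ha, norm_inv, inv_inv]⟩

variable {A K L : Type*} [NontriviallyNormedField K] [IsUltrametricDist K] [CompleteSpace K]
  [NormedField L] [NormedAlgebra K L] [CommRing A] [Algebra A K] [Algebra A L]
  [IsScalarTower A K L]

theorem isIntegral_iff_norm_le_one [Algebra.IsAlgebraic K L]
    (hA : (valuation (K := K)).Integers A) (x : L) : IsIntegral A x ↔ ‖x‖ ≤ 1 := by
  have : IsDomain A := hA.hom_inj.isDomain
  have : IsFractionRing A K := hA.isFractionRing
  have : ValuationRing A := .of_integers valuation hA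
  have hm := minpoly.monic (Algebra.IsIntegral.isIntegral (R := K) x)
  rw [NormedAlgebra.norm_eq_spectralNorm K x, spectralNorm, spectralValue_le_one_iff hm]
  refine ⟨fun h i ↦ ?_, fun h ↦ ?_⟩
  · rw [minpoly.isIntegrallyClosed_eq_field_fractions' K h, coeff_map]
    exact hA.map_le_one _
  · have hlift : minpoly K x ∈ lifts (algebraMap A K) :=
      (lifts_iff_coeff_lifts _).mpr fun i ↦ hA.exists_of_le_one (h i)
    obtain ⟨g, hg, -, hgm⟩ := lifts_and_natDegree_eq_and_monic hlift hm
    refine ⟨g, hgm, ?_⟩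
    rw [← aeval_def, ← aeval_map_algebraMap K, hg, minpoly.aeval]

theorem integers_integralClosure [Algebra.IsAlgebraic K L] [IsUltrametricDist L]
    (hA : (valuation (K := K)).Integers A) :
    (valuation (K := L)).Integers (integralClosure A L) where
  hom_inj := Subtype.val_injective
  map_le_one x := (isIntegral_iff_norm_le_one hA (x : L)).mp x.2
  exists_of_le_one r hr := ⟨⟨r, (isIntegral_iff_norm_le_one hA r).mpr hr⟩, rfl⟩

variable [IsDomain A] [IsDiscreteValuationRing A] [FiniteDimensional K L]
  [Algebra.IsSeparable K L]

theorem isDiscreteValuationRing_integralClosure (hA : (valuation (K := K)).Integers A) :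
    IsDiscreteValuationRing (integralClosure A L) := by
  have := IsUltrametricDist.of_normedAlgebra (L := L) K
  have : IsFractionRing A K := hA.isFractionRing
  have := FaithfulSMul.trans A K L
  have : ValuationRing (integralClosure A L) := .of_integers _ (integers_integralClosure hA)
  have : IsDedekindDomain (integralClosure A L) := IsIntegralClosure.isDedekindDomain A K L _
  have hfield : ¬ IsField (integralClosure A L) := fun h ↦
    IsDiscreteValuationRing.not_isField A (isField_of_isIntegral_of_isField
      (FaithfulSMul.algebraMap_injective A (integralClosure A L)) h)
  exact ((IsDiscreteValuationRing.TFAE (integralClosure A L) hfield).out 2 0).mp ‹_›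

theorem irreducible_algebraMap_of_formallyUnramified (hA : (valuation (K := K)).Integers A)
    [Algebra.FormallyUnramified A (integralClosure A L)] {ϖ : A} (hϖ : Irreducible ϖ) :
    Irreducible (algebraMap A (integralClosure A L) ϖ) := by
  have : IsFractionRing A K := hA.isFractionRing
  have := isDiscreteValuationRing_integralClosure (L := L) hA
  have : Module.Finite A (integralClosure A L) := IsIntegralClosure.finite A K L _
  have := FaithfulSMul.trans A K L
  have h := Algebra.FormallyUnramified.map_maximalIdeal (R := A) (S := integralClosure A L)
  rw [hϖ.maximalIdeal_eq, Ideal.map_span, Set.image_singleton] at h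
  exact (IsDiscreteValuationRing.irreducible_iff_uniformizer _).mpr h.symm

theorem exists_norm_eq_zpow_of_formallyUnramified (hA : (valuation (K := K)).Integers A)
    [Algebra.FormallyUnramified A (integralClosure A L)] {ϖ : A} (hϖ : Irreducible ϖ) {x : L}
    (hx : x ≠ 0) : ∃ n : ℤ, ‖x‖ = ‖algebraMap A K ϖ‖ ^ n := by
  have := IsUltrametricDist.of_normedAlgebra (L := L) K
  have := isDiscreteValuationRing_integralClosure (L := L) hA
  obtain ⟨n, hn⟩ := exists_norm_eq_zpow (integers_integralClosure (L := L) hA)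
    (irreducible_algebraMap_of_formallyUnramified hA hϖ) hx
  refine ⟨n, ?_⟩
  rw [hn, ← IsScalarTower.algebraMap_apply, IsScalarTower.algebraMap_apply A K L,
    norm_algebraMap']

theorem formallyUnramified_of_norm_aeval_derivative_minpoly
    (hA : (valuation (K := K)).Integers A) {u : L} (hu : ‖u‖ ≤ 1) (hgen : K⟮u⟯ = ⊤)
    (hder : ‖aeval u (minpoly K u).derivative‖ = 1) :
    Algebra.FormallyUnramified A (integralClosure A L) := by
  have := IsUltrametricDist.of_normedAlgebra (L := L) K
  have : IsFractionRing A K := hA.isFractionRing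
  have := isDiscreteValuationRing_integralClosure (L := L) hA
  have hB := integers_integralClosure (L := L) hA
  have : IsFractionRing (integralClosure A L) L := hB.isFractionRing
  obtain ⟨u, rfl⟩ := hB.exists_of_le_one hu
  refine formallyUnramified_of_isUnit_aeval_derivative_minpoly (K := K) (L := L) (u := u) ?_ ?_
  · rw [← IntermediateField.adjoin_simple_toSubalgebra_of_isAlgebraic
      (Algebra.IsAlgebraic.isAlgebraic _), hgen, IntermediateField.top_toSubalgebra]
  · rw [minpoly.isIntegrallyClosed_eq_field_fractions K L (IsIntegralClosure.isIntegral A L u),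
      derivative_map, aeval_map_algebraMap, aeval_algebraMap_apply] at hder
    exact hB.isUnit_iff_valuation_eq_one.mpr (NNReal.eq hder)

theorem formallyUnramified_iff_exists_norm_eq (hA : (valuation (K := K)).Integers A)
    (hq : (Module.finrank K L).Prime) (hq1 : ‖(Module.finrank K L : K)‖ = 1) {x : L}
    (hx : x ∉ Set.range (algebraMap K L)) (htr : Algebra.trace K L x = 0) :
    Algebra.FormallyUnramified A (integralClosure A L) ↔ ∃ c : K, ‖c‖ = ‖x‖ := by
  have hx0 : x ≠ 0 := fun h ↦ hx ⟨0, by rw [map_zero, h]⟩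
  constructor
  · intro _
    obtain ⟨ϖ, hϖ⟩ := IsDiscreteValuationRing.exists_irreducible A
    obtain ⟨n, hn⟩ := exists_norm_eq_zpow_of_formallyUnramified hA hϖ hx0
    exact ⟨algebraMap A K ϖ ^ n, by rw [norm_zpow, hn]⟩
  · rintro ⟨c, hc⟩
    have hc0 : c ≠ 0 := norm_ne_zero_iff.mp (hc ▸ norm_ne_zero_iff.mpr hx0)
    have hu : ‖c⁻¹ • x‖ = 1 := by
      rw [norm_smul, norm_inv, hc, inv_mul_cancel₀ (norm_ne_zero_iff.mpr hx0)]
    have huK : c⁻¹ • x ∉ Set.range (algebraMap K L) := fun ⟨d, hd⟩ ↦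
      hx ⟨c * d, by rw [map_mul, hd, ← Algebra.smul_def, smul_inv_smul₀ hc0]⟩
    have hdeg := natDegree_minpoly_eq_of_finrank_prime hq huK
    have hnext : (minpoly K (c⁻¹ • x)).nextCoeff = 0 :=
      nextCoeff_minpoly_eq_zero_of_trace_eq_zero (norm_ne_zero_iff.mp (hq1 ▸ one_ne_zero))
        (by rw [map_smul, htr, smul_zero])
    refine formallyUnramified_of_norm_aeval_derivative_minpoly hA hu.le
      ((Field.primitive_element_iff_minpoly_natDegree_eq K _).mpr hdeg) ?_
    rw [norm_aeval_derivative_minpoly (hdeg ▸ hq) (hdeg ▸ hq1) hnext, hu, one_pow]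

end Integers

theorem natDegree_minpoly_eq_of_irreducible {A K L : Type*} [CommRing A] [IsDomain A]
    [IsGCDMonoid A] [Field K] [Algebra A K] [IsFractionRing A K] [Field L] [Algebra K L]
    [Algebra A L] [IsScalarTower A K L] {f : A[X]} (hf : Irreducible f) (hf0 : f.natDegree ≠ 0)
    {θ : L} (hθ : aeval θ f = 0) : (minpoly K θ).natDegree = f.natDegree := by
  have hirr : Irreducible (f.map (algebraMap A K)) :=
    (hf.isPrimitive hf0).irreducible_iff_irreducible_map_fraction_map.mp hf
  rw [← minpoly.eq_of_irreducible hirr (by rw [aeval_map_algebraMap, hθ]),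
    natDegree_mul_C (inv_ne_zero (leadingCoeff_ne_zero.mpr hirr.ne_zero)),
    natDegree_map_eq_of_injective (IsFractionRing.injective A K)]

theorem isUnramifiedExtension_iff_formallyUnramified {A L : Type*} (K : Type*) [CommRing A]
    [IsDomain A] [IsIntegrallyClosed A] [IsNoetherianRing A] [Field K] [Algebra A K]
    [IsFractionRing A K] [Field L] [Algebra A L] [Algebra K L] [IsScalarTower A K L]
    [FiniteDimensional K L] [Algebra.IsSeparable K L] :
    IsUnramifiedExtension A L ↔ Algebra.FormallyUnramified A (integralClosure A L) := by
  refine ⟨fun h ↦ h.formallyUnramified, fun h ↦ ⟨h, ?_⟩⟩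
  have : Module.Finite A (integralClosure A L) := IsIntegralClosure.finite A K L _
  infer_instance

section DiscretelyValued

open NormedField

variable {A K L : Type*} [NontriviallyNormedField K] [IsUltrametricDist K] [CompleteSpace K]
  [CommRing A] [IsDomain A] [IsDiscreteValuationRing A] [Algebra A K]

theorem isUnramifiedExtension_iff_exists_norm_discr_eq [NormedField L] [NormedAlgebra K L]
    [Algebra A L] [IsScalarTower A K L] [FiniteDimensional K L]
    (hA : (valuation (K := K)).Integers A) (hq : (Module.finrank K L).Prime)
    (hq1 : ‖(Module.finrank K L : K)‖ = 1) {f : A[X]} (hf : f.IsPrimitive)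
    (hdeg : f.natDegree = Module.finrank K L) {θ : L} (hθK : θ ∉ Set.range (algebraMap K L))
    (hθ : aeval θ f = 0) :
    IsUnramifiedExtension A L ↔ ∃ c : K,
      ‖algebraMap A K f.discr‖ = ‖c‖ ^ (Module.finrank K L * (Module.finrank K L - 1)) := by
  have hq0 : (Module.finrank K L : K) ≠ 0 := norm_ne_zero_iff.mp (hq1 ▸ one_ne_zero)
  have := isSeparable_of_finrank_ne_zero hq0
  have : IsFractionRing A K := hA.isFractionRing
  have hexp : Module.finrank K L * (Module.finrank K L - 1) ≠ 0 :=
    mul_ne_zero hq.ne_zero (Nat.sub_ne_zero_of_lt hq.one_lt)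
  rw [isUnramifiedExtension_iff_formallyUnramified K, formallyUnramified_iff_exists_norm_eq hA hq
    hq1 (traceZeroPart_notMem_range hθK) (trace_traceZeroPart hq0 θ),
    ← exists_norm_eq_div_max_sq_iff hq1, norm_discr_of_finrank_prime hA hq hq1 hf hdeg hθK hθ]
  refine exists_congr fun c ↦ ?_
  rw [pow_left_inj₀ (by positivity) (norm_nonneg c) hexp, eq_comm]

theorem mainTheorem7_general [Field L] [Algebra K L] [Algebra A L] [IsScalarTower A K L]
    (hA : (valuation (K := K)).Integers A) {q : ℕ} (hq : q.Prime) (hq1 : ‖(q : K)‖ = 1)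
    {f : A[X]} (hf : Irreducible f) (hdeg : f.natDegree = q) {θ : L} (hθ : aeval θ f = 0) :
    IsUnramifiedExtension A K⟮θ⟯ ↔ ∃ c : K, ‖algebraMap A K f.discr‖ = ‖c‖ ^ (q * (q - 1)) := by
  have : IsFractionRing A K := hA.isFractionRing
  have hf0 : f.natDegree ≠ 0 := hdeg ▸ hq.ne_zero
  have hmin : (minpoly K θ).natDegree = q :=
    (natDegree_minpoly_eq_of_irreducible hf hf0 hθ).trans hdeg
  have hint : IsIntegral K θ := minpoly.ne_zero_iff.mp
    (ne_zero_of_natDegree_gt (hmin ▸ hq.pos))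
  have : FiniteDimensional K K⟮θ⟯ := IntermediateField.adjoin.finiteDimensional hint
  have hrank : Module.finrank K K⟮θ⟯ = q := by rw [IntermediateField.adjoin.finrank hint, hmin]
  let : NormedField K⟮θ⟯ := spectralNorm.normedField K K⟮θ⟯
  let : NormedAlgebra K K⟮θ⟯ := spectralNorm.normedAlgebra K K⟮θ⟯
  subst hrank
  refine isUnramifiedExtension_iff_exists_norm_discr_eq hA hq hq1 (hf.isPrimitive hf0) hdeg
    (θ := IntermediateField.AdjoinSimple.gen K θ) ?_ ?_
  · rw [← RingHom.coe_range, SetLike.mem_coe, ← minpoly.natDegree_eq_one_iff,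
      IntermediateField.minpoly_gen, hmin]
    exact hq.ne_one
  · apply (algebraMap K⟮θ⟯ L).injective
    rw [← aeval_map_algebraMap K, ← aeval_algebraMap_apply,
      IntermediateField.AdjoinSimple.algebraMap_gen, aeval_map_algebraMap, hθ, map_zero]

end DiscretelyValued

section Padic

open NormedField

variable {p : ℕ} [Fact p.Prime]

variable (p) in
theorem integers_padicInt : (valuation (K := ℚ_[p])).Integers ℤ_[p] where
  hom_inj := Subtype.val_injective
  map_le_one x := x.2
  exists_of_le_one r hr := ⟨⟨r, hr⟩, rfl⟩

variable {K : Type*} [NormedField K] [NormedAlgebra ℚ_[p] K]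

variable (K) in
theorem norm_natCast_eq_one_of_coprime {n : ℕ} (hn : p.Coprime n) : ‖(n : K)‖ = 1 := by
  rw [← map_natCast (algebraMap ℚ_[p] K), norm_algebraMap', Padic.norm_natCast_eq_one_iff]
  exact hn

theorem extPadicVal_eq_iff_norm_eq_zpow [Algebra.IsAlgebraic ℚ_[p] K] {x : K} (hx : x ≠ 0) (k : ℤ) :
    extPadicVal p K x = k ↔ ‖x‖ = (p : ℝ)⁻¹ ^ k := by
  have hp : (1 : ℝ) < p := by exact_mod_cast (Fact.out : p.Prime).one_lt
  rw [extPadicVal, ← NormedAlgebra.norm_eq_spectralNorm, neg_eq_iff_eq_neg,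
    Real.logb_eq_iff_rpow_eq (one_pos.trans hp) hp.ne' (norm_pos_iff.mpr hx),
    Real.rpow_neg (one_pos.trans hp).le, Real.rpow_intCast, inv_zpow, eq_comm]

theorem exists_norm_eq_pow_iff_exists_extPadicVal_eq_mul [FiniteDimensional ℚ_[p] K]
    [Algebra ℤ_[p] K] [IsScalarTower ℤ_[p] ℚ_[p] K] (hK : IsUnramifiedExtension ℤ_[p] K)
    {m : ℕ} (hm : m ≠ 0) (x : K) :
    (∃ c : K, ‖x‖ = ‖c‖ ^ m) ↔ ∃ k : ℤ, extPadicVal p K x = k * m := by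
  rcases eq_or_ne x 0 with rfl | hx
  · exact iff_of_true ⟨0, by simp [hm]⟩ ⟨0, by simp [extPadicVal, spectralNorm_zero]⟩
  have hval (k : ℤ) : extPadicVal p K x = k * m ↔ ‖x‖ = ((p : ℝ)⁻¹ ^ k) ^ m := by
    rw [← zpow_natCast, ← zpow_mul, ← extPadicVal_eq_iff_norm_eq_zpow hx]
    push_cast
    rfl
  simp only [hval]
  constructor
  · rintro ⟨c, hc⟩
    have hc0 : c ≠ 0 := by
      rintro rfl
      simp [hm, hx] at hc
    have := hK.formallyUnramified
    obtain ⟨n, hn⟩ := exists_norm_eq_zpow_of_formallyUnramified (integers_padicInt p)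
      PadicInt.irreducible_p hc0
    exact ⟨n, by simpa [hn] using hc⟩
  · rintro ⟨k, hk⟩
    exact ⟨algebraMap ℚ_[p] K (p ^ k), by rw [norm_algebraMap', norm_zpow, Padic.norm_p, hk]⟩

end Padic

theorem mainTheorem7 (p q : ℕ) [Fact p.Prime] (hq : q.Prime) (hqp : q ≠ p)
    (K : Type*) [Field K] [Algebra ℚ_[p] K] [FiniteDimensional ℚ_[p] K]
    [Algebra ℤ_[p] K] [IsScalarTower ℤ_[p] ℚ_[p] K]
    (hK : IsUnramifiedExtension ℤ_[p] K)
    (f : (integralClosure ℤ_[p] K)[X]) (hf : Irreducible f) (hdeg : f.natDegree = q)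
    (L : Type*) [Field L] [Algebra K L] (θ : L) (hθ : aeval θ f = 0) :
    IsUnramifiedExtension (integralClosure ℤ_[p] K) K⟮θ⟯ ↔
      ∃ k : ℤ, extPadicVal p K (f.discr : K) = k * ((q : ℝ) * ((q : ℝ) - 1)) := by
  let : NontriviallyNormedField K := spectralNorm.nontriviallyNormedField ℚ_[p] K
  let : NormedAlgebra ℚ_[p] K := spectralNorm.normedAlgebra ℚ_[p] K
  have : IsUltrametricDist K := .of_normedAlgebra ℚ_[p]
  have : CompleteSpace K := FiniteDimensional.complete ℚ_[p] K
  have := isDiscreteValuationRing_integralClosure (L := K) (integers_padicInt p)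
  have hq' : ((q * (q - 1) : ℕ) : ℝ) = q * ((q : ℝ) - 1) := by
    rw [Nat.cast_mul, Nat.cast_sub hq.one_le, Nat.cast_one]
  have hq1 := norm_natCast_eq_one_of_coprime K ((Nat.coprime_primes Fact.out hq).mpr hqp.symm)
  rw [mainTheorem7_general (integers_integralClosure (integers_padicInt p)) hq hq1 hf hdeg hθ,
    ← hq']
  exact exists_norm_eq_pow_iff_exists_extPadicVal_eq_mul hK
    (mul_ne_zero hq.ne_zero (Nat.sub_ne_zero_of_lt hq.one_lt)) _
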